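/- Let $n\ge 1$. A dyadic grid $\mathcal D$ on $\mathbb R^n$ is a collection of axis-parallel cubes such that every $Q\in\mathcal D$ has side length $2^k$ for some $k\in\mathbb Z$; for each $k\in\mathbb Z$ the cubes of $\mathcal D$ of side length $2^k$ partition $\mathbb R^n$; and $P\cap Q\in\{P,Q,\emptyset\}$ for all $P,Q\in\mathcal D$. For $Q_0\in\mathcal D$ put $\mathcal D(Q_0)=\{Q\in\mathcal D: Q\subset Q_0\}$. Write $\langle f\rangle_Q=\frac1{|Q|}\int_Q f\,dx$. A weight is a locally integrable, a.e. positive function $w$ on $\mathbb R^n$, and $w(Q)=\int_Q w\,dx$. A locally integrable real function $b$ belongs to $BMO^{\mathcal D}(w)$ if $$\|b\|_{BMO^{\mathcal D}(w)}:=\sup_{Q\in\mathcal D}\frac1{w(Q)}\int_Q|b-\langle b\rangle_Q|\,dx<\infty .$$ For $\Lambda>1$, a collection $\mathcal S\subset\mathcal D$ is $\Lambda$-Carleson if $\sum_{P\in\mathcal S,\,P\subset Q}|P|\le\Lambda|Q|$ for all $Q\in\mathcal D$; for $0<\eta<1$ it is $\eta$-sparse if there are pairwise disjoint measurable sets $E_Q\subset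 Q$ $(Q\in\mathcal S)$ with $|E_Q|\ge\eta|Q|$. **Corollary.** For every $n\ge1$ there is a constant $C(n)>0$, depending only on $n$, such that for every dyadic grid $\mathcal D$ on $\mathbb R^n$, every $\Lambda>1$, every weight $w$ on $\mathbb R^n$, every $b\in BMO^{\mathcal D}(w)$ and every $Q_0\in\mathcal D$, there is a collection $\mathcal S(Q_0)\subset\mathcal D(Q_0)$ which is $\Lambda$-Carleson and $\frac1\Lambda$-sparse, and has no infinite strictly increasing chain $Q_1\subsetneq Q_2\subsetneq\cdots$, such that for almost every $x\in\mathbb R^n$ $$\big|(b(x)-\langle b\rangle_{Q_0})\,1_{Q_0}(x)\big|\le C(n)\Big(\frac{\Lambda}{\Lambda-1}\Big)^2\|b\|_{BMO^{\mathcal D}(w)}\;b^w_{\mathcal S(Q_0)}(x),\qquad b^w_{\mathcal S}:=\sum_{Q\in\mathcal S}\langle w\rangle_Q 1_Q .$$ In other words, local oscillations of weighted BMO functions are dominated pointwise almost everywhere by sparse BMO functions. -/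

import Mathlib

open MeasureTheory Set
open scoped ENNReal

namespace SparseBMO

/-- `Q` is an axis-parallel cube of side length `l` in `ℝⁿ`: a product of intervals
(each open, closed or half-open) with end points `a i` and `a i + l`.
`Fin n → ℝ` is used only through its topology and its Lebesgue measure. -/
def IsCube {n : ℕ} (l : ℝ) (Q : Set (Fin n → ℝ)) : Prop :=
  ∃ (a : Fin n → ℝ) (I : Fin n → Set ℝ),
    (∀ i, Ioo (a i) (a i + l) ⊆ I i ∧ I i ⊆ Icc (a i) (a i + l)) ∧ Q = Set.pi univ I

/-- A dyadic grid on `ℝⁿ`. -/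
structure IsDyadicGrid {n : ℕ} (D : Set (Set (Fin n → ℝ))) : Prop where
  /-- Every member is a cube of side length `2 ^ k` for an integer `k`. -/
  side : ∀ Q ∈ D, ∃ k : ℤ, IsCube ((2 : ℝ) ^ k) Q
  /-- For each fixed integer `k`, the members of side length `2 ^ k` partition `ℝⁿ`. -/
  partition : ∀ k : ℤ, Setoid.IsPartition {Q | Q ∈ D ∧ IsCube ((2 : ℝ) ^ k) Q}
  /-- Two members are nested or disjoint. -/
  nested : ∀ P ∈ D, ∀ Q ∈ D, P ∩ Q = P ∨ P ∩ Q = Q ∨ P ∩ Q = ∅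

/-- The members of the grid contained in `Q₀`. -/
def subcubes {n : ℕ} (D : Set (Set (Fin n → ℝ))) (Q₀ : Set (Fin n → ℝ)) :
    Set (Set (Fin n → ℝ)) :=
  {Q | Q ∈ D ∧ Q ⊆ Q₀}

/-- The Lebesgue average of `f` over `Q`. -/
noncomputable def avg {n : ℕ} (f : (Fin n → ℝ) → ℝ) (Q : Set (Fin n → ℝ)) : ℝ :=
  ⨍ x in Q, f x ∂volume

/-- A weight: a locally integrable, a.e. positive function. -/
structure IsWeight {n : ℕ} (w : (Fin n → ℝ) → ℝ) : Prop where
  locallyIntegrable : LocallyIntegrable w volume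
  ae_pos : ∀ᵐ x ∂(volume : Measure (Fin n → ℝ)), 0 < w x

/-- `w(Q) = ∫_Q w dx`. -/
noncomputable def weightMass {n : ℕ} (w : (Fin n → ℝ) → ℝ) (Q : Set (Fin n → ℝ)) : ℝ≥0∞ :=
  ∫⁻ x in Q, ENNReal.ofReal (w x) ∂volume

/-- The weighted dyadic BMO norm `sup_{Q ∈ D} w(Q)⁻¹ ∫_Q |b - ⟨b⟩_Q| dx`, possibly infinite. -/
noncomputable def bmoNorm {n : ℕ} (D : Set (Set (Fin n → ℝ))) (w b : (Fin n → ℝ) → ℝ) : ℝ≥0∞ :=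
  ⨆ Q ∈ D, (∫⁻ x in Q, ‖b x - avg b Q‖ₑ ∂volume) / weightMass w Q

/-- Membership in the weighted dyadic BMO space. -/
structure MemBMO {n : ℕ} (D : Set (Set (Fin n → ℝ))) (w b : (Fin n → ℝ) → ℝ) : Prop where
  locallyIntegrable : LocallyIntegrable b volume
  norm_lt_top : bmoNorm D w b < ⊤

/-- `S` is `Λ`-Carleson: `∑_{P ∈ S, P ⊆ Q} |P| ≤ Λ |Q|` for every `Q` in the grid. -/
def IsCarleson {n : ℕ} (D : Set (Set (Fin n → ℝ))) (Λ : ℝ) (S : Set (Set (Fin n → ℝ))) : Prop :=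
  S ⊆ D ∧ ∀ Q ∈ D,
    ∑' P : {P : Set (Fin n → ℝ) // P ∈ S ∧ P ⊆ Q}, volume P.1 ≤ ENNReal.ofReal Λ * volume Q

/-- `S` is `η`-sparse: there are pairwise disjoint measurable `E Q ⊆ Q`, `Q ∈ S`, with
`|E Q| ≥ η |Q|`. -/
def IsSparse {n : ℕ} (D : Set (Set (Fin n → ℝ))) (η : ℝ) (S : Set (Set (Fin n → ℝ))) : Prop :=
  S ⊆ D ∧ ∃ E : Set (Fin n → ℝ) → Set (Fin n → ℝ),
    (∀ Q ∈ S, MeasurableSet (E Q) ∧ E Q ⊆ Q ∧ ENNReal.ofReal η * volume Q ≤ volume (E Q)) ∧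
      S.PairwiseDisjoint E

/-- `S` contains an infinite strictly increasing chain of cubes. -/
def HasInfinitelyIncreasingChain {n : ℕ} (S : Set (Set (Fin n → ℝ))) : Prop :=
  ∃ Q : ℕ → Set (Fin n → ℝ), (∀ k, Q k ∈ S) ∧ ∀ k, Q k ⊂ Q (k + 1)

/-- The weighted sparse BMO function `∑_{Q ∈ S} ⟨w⟩_Q 1_Q`, with values in `[0, ∞]`. -/
noncomputable def sparseFun {n : ℕ} (w : (Fin n → ℝ) → ℝ) (S : Set (Set (Fin n → ℝ)))
    (x : Fin n → ℝ) : ℝ≥0∞ :=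
  ∑' Q : S, (Q : Set (Fin n → ℝ)).indicator (fun _ => ENNReal.ofReal (avg w Q)) x

end SparseBMO

/-! This is a Calderón–Zygmund stopping-time argument with threshold `t Q` equal to `A * ‖b‖ *
⟨w⟩_Q`, where `A = Λ / (Λ - 1)`. From `Q`, stop at the maximal proper subcubes on which the mean of
`|b - ⟨b⟩_Q|` exceeds `t Q`, and iterate from `Q₀`. By Chebyshev and the BMO bound the children
cover at most the fraction `1 / A = 1 - 1 / Λ` of `Q`, so the uncovered remainders witness
sparseness (`isSparse_stoppingFamily`), and sparseness gives the Carleson bound.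

By that bound, almost every `x` lies in finitely many stopping cubes. Let `P` be the smallest.
Lebesgue differentiation gives `|b(x) - ⟨b⟩_P| ≤ t P`; since the dyadic parent of a child is not
stopped, each jump of averages from `Q` to a child is at most `2 ^ n * t Q`
(`enorm_avg_sub_avg_le`). Telescoping up to `Q₀` gives the pointwise bound (`ae_enorm_sub_avg_le`).
-/

namespace SparseBMO

/-! ### Cubes as sup-norm balls -/

section Cube

variable {n : ℕ} {l : ℝ} {Q : Set (Fin n → ℝ)}

lemma IsCube.measurableSet (h : IsCube l Q) : MeasurableSet Q := by
  obtain ⟨a, I, hI, rfl⟩ := h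
  refine MeasurableSet.univ_pi fun i => OrdConnected.measurableSet ⟨fun x hx y hy z hz => ?_⟩
  rcases eq_or_lt_of_le hz.1 with rfl | h1
  · exact hx
  rcases eq_or_lt_of_le hz.2 with rfl | h2
  · exact hy
  exact (hI i).1 ⟨((hI i).2 hx).1.trans_lt h1, h2.trans_le ((hI i).2 hy).2⟩

lemma IsCube.exists_ball (hl : 0 < l) (h : IsCube l Q) :
    ∃ c, Metric.ball c (l / 2) ⊆ Q ∧ Q ⊆ Metric.closedBall c (l / 2) := by
  obtain ⟨a, I, hI, rfl⟩ := h
  refine ⟨fun i => a i + l / 2, ?_, ?_⟩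
  · rw [ball_pi _ (half_pos hl)]
    refine pi_mono fun i _ => ?_
    rw [Real.ball_eq_Ioo]
    convert (hI i).1 using 2 <;> ring
  · rw [closedBall_pi _ (half_pos hl).le]
    refine pi_mono fun i _ => ?_
    rw [Real.closedBall_eq_Icc]
    convert (hI i).2 using 2 <;> ring

lemma IsCube.volume_eq (hl : 0 < l) (h : IsCube l Q) : volume Q = ENNReal.ofReal (l ^ n) := by
  obtain ⟨c, h1, h2⟩ := h.exists_ball hl
  have e1 := Real.volume_pi_ball c (half_pos hl)
  have e2 := Real.volume_pi_closedBall c (half_pos hl).le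
  rw [Fintype.card_fin, mul_div_cancel₀ _ two_ne_zero] at e1 e2
  exact le_antisymm ((measure_mono h2).trans e2.le) (e1.ge.trans (measure_mono h1))

/-- Lets averages over cubes be read as averages over closed balls, the form used by the
differentiation theorem. -/
lemma IsCube.exists_ae_eq_closedBall (hl : 0 < l) (h : IsCube l Q) :
    ∃ c, Q ⊆ Metric.closedBall c (l / 2) ∧ Q =ᵐ[volume] Metric.closedBall c (l / 2) := by
  obtain ⟨c, -, h2⟩ := h.exists_ball hl
  have e2 := Real.volume_pi_closedBall c (half_pos hl).le
  rw [Fintype.card_fin, mul_div_cancel₀ _ two_ne_zero] at e2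
  refine ⟨c, h2, ae_eq_of_subset_of_measure_ge h2 ?_ h.measurableSet.nullMeasurableSet ?_⟩
  · rw [e2, h.volume_eq hl]
  · rw [e2]; exact ENNReal.ofReal_ne_top

end Cube

/-! ### Combinatorics and differentiation on a dyadic grid -/

section Grid

variable {n : ℕ} {D : Set (Set (Fin n → ℝ))} {P Q R : Set (Fin n → ℝ)}

lemma IsDyadicGrid.measurableSet (hD : IsDyadicGrid D) (hQ : Q ∈ D) : MeasurableSet Q := by
  obtain ⟨k, hk⟩ := hD.side Q hQ
  exact hk.measurableSet

lemma IsDyadicGrid.volume_ne_top (hD : IsDyadicGrid D) (hQ : Q ∈ D) : volume Q ≠ ⊤ := by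
  obtain ⟨k, hk⟩ := hD.side Q hQ
  rw [hk.volume_eq (by positivity)]
  exact ENNReal.ofReal_ne_top

lemma IsDyadicGrid.volume_ne_zero (hD : IsDyadicGrid D) (hQ : Q ∈ D) : volume Q ≠ 0 := by
  obtain ⟨k, hk⟩ := hD.side Q hQ
  rw [hk.volume_eq (by positivity)]
  exact (ENNReal.ofReal_pos.2 (by positivity)).ne'

lemma IsDyadicGrid.nonempty (hD : IsDyadicGrid D) (hQ : Q ∈ D) : Q.Nonempty :=
  nonempty_of_measure_ne_zero (hD.volume_ne_zero hQ)

lemma IsDyadicGrid.integrableOn (hD : IsDyadicGrid D) (hQ : Q ∈ D) {f : (Fin n → ℝ) → ℝ}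
    (hf : LocallyIntegrable f volume) : IntegrableOn f Q volume := by
  obtain ⟨k, hk⟩ := hD.side Q hQ
  obtain ⟨c, -, hc⟩ := hk.exists_ball (by positivity)
  exact (hf.integrableOn_isCompact (isCompact_closedBall _ _)).mono_set hc

lemma IsDyadicGrid.exists_mem (hD : IsDyadicGrid D) (k : ℤ) (x : Fin n → ℝ) :
    ∃ Q ∈ D, IsCube ((2 : ℝ) ^ k) Q ∧ x ∈ Q := by
  obtain ⟨Q, ⟨h1, h2⟩, -⟩ := (hD.partition k).2 x
  exact ⟨Q, h1.1, h1.2, h2⟩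

lemma IsDyadicGrid.eq_of_mem (hD : IsDyadicGrid D) {k : ℤ} (hP : P ∈ D) (hQ : Q ∈ D)
    (hPk : IsCube ((2 : ℝ) ^ k) P) (hQk : IsCube ((2 : ℝ) ^ k) Q) {x : Fin n → ℝ}
    (hxP : x ∈ P) (hxQ : x ∈ Q) : P = Q :=
  ((hD.partition k).2 x).unique ⟨⟨hP, hPk⟩, hxP⟩ ⟨⟨hQ, hQk⟩, hxQ⟩

lemma IsDyadicGrid.subset_or_subset (hD : IsDyadicGrid D) (hP : P ∈ D) (hQ : Q ∈ D)
    {x : Fin n → ℝ} (hxP : x ∈ P) (hxQ : x ∈ Q) : P ⊆ Q ∨ Q ⊆ P := by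
  rcases hD.nested P hP Q hQ with h | h | h
  · exact .inl (inter_eq_left.1 h)
  · exact .inr (inter_eq_right.1 h)
  · exact absurd (h ▸ ⟨hxP, hxQ⟩ : x ∈ (∅ : Set (Fin n → ℝ))) (notMem_empty x)

/-- Compare volumes; in dimension `0` every volume is `1`, whence `1 ≤ n`. -/
lemma IsCube.le_of_subset (hn : 1 ≤ n) {j k : ℤ} (hP : IsCube ((2 : ℝ) ^ j) P)
    (hQ : IsCube ((2 : ℝ) ^ k) Q) (h : P ⊆ Q) : j ≤ k := by
  have := measure_mono (μ := volume) h
  rw [hP.volume_eq (by positivity), hQ.volume_eq (by positivity),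
    ENNReal.ofReal_le_ofReal_iff (by positivity),
    pow_le_pow_iff_left₀ (by positivity) (by positivity) (by omega)] at this
  exact (zpow_le_zpow_iff_right₀ one_lt_two).1 this

lemma IsDyadicGrid.subset_of_le (hn : 1 ≤ n) (hD : IsDyadicGrid D) {j k : ℤ} (hP : P ∈ D)
    (hQ : Q ∈ D) (hPj : IsCube ((2 : ℝ) ^ j) P) (hQk : IsCube ((2 : ℝ) ^ k) Q) (hjk : j ≤ k)
    {x : Fin n → ℝ} (hxP : x ∈ P) (hxQ : x ∈ Q) : P ⊆ Q := by
  rcases hD.subset_or_subset hP hQ hxP hxQ with h | h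
  · exact h
  · obtain rfl := le_antisymm hjk (hQk.le_of_subset hn hPj h)
    exact (hD.eq_of_mem hP hQ hPj hQk hxP hxQ).subset

lemma IsDyadicGrid.lt_of_ssubset (hn : 1 ≤ n) (hD : IsDyadicGrid D) {j k : ℤ} (hP : P ∈ D)
    (hQ : Q ∈ D) (hPj : IsCube ((2 : ℝ) ^ j) P) (hQk : IsCube ((2 : ℝ) ^ k) Q) (h : P ⊂ Q) :
    j < k := by
  obtain ⟨x, hx⟩ := hD.nonempty hP
  by_contra! hkj
  exact h.2 (hD.subset_of_le hn hQ hP hQk hPj hkj (h.1 hx) hx)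

/-- The integer side exponents occurring in `T` are bounded by that of `Q`, so a largest one is
attained. -/
lemma IsDyadicGrid.exists_maximal (hn : 1 ≤ n) (hD : IsDyadicGrid D) (hQ : Q ∈ D)
    {T : Set (Set (Fin n → ℝ))} (hT : T ⊆ subcubes D Q) (hne : T.Nonempty) :
    ∃ P ∈ T, ∀ R ∈ T, ¬ P ⊂ R := by
  obtain ⟨k, hk⟩ := hD.side Q hQ
  obtain ⟨j, ⟨P, hPT, hPj⟩, hj⟩ := Int.exists_greatest_of_bdd
    (P := fun j : ℤ => ∃ P ∈ T, IsCube ((2 : ℝ) ^ j) P)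
    ⟨k, fun j ⟨P, hP, hPj⟩ => hPj.le_of_subset hn hk (hT hP).2⟩
    (by obtain ⟨P, hP⟩ := hne
        obtain ⟨j, hj⟩ := hD.side P (hT hP).1
        exact ⟨j, P, hP, hj⟩)
  refine ⟨P, hPT, fun R hR hPR => ?_⟩
  obtain ⟨i, hi⟩ := hD.side R (hT hR).1
  exact (hD.lt_of_ssubset hn (hT hPT).1 (hT hR).1 hPj hi hPR).not_ge (hj i ⟨R, hR, hi⟩)

lemma IsDyadicGrid.not_hasInfinitelyIncreasingChain (hn : 1 ≤ n) (hD : IsDyadicGrid D)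
    (hQ : Q ∈ D) {S : Set (Set (Fin n → ℝ))} (hS : S ⊆ subcubes D Q) :
    ¬ HasInfinitelyIncreasingChain S := by
  rintro ⟨P, hPS, hP⟩
  obtain ⟨-, ⟨k, rfl⟩, hk⟩ := hD.exists_maximal hn hQ (T := range P)
    (by rintro - ⟨k, rfl⟩; exact hS (hPS k)) (range_nonempty P)
  exact hk _ ⟨k + 1, rfl⟩ (hP k)

/-- The parent of a cube that is strictly contained in `Q`. -/
lemma IsDyadicGrid.exists_parent (hn : 1 ≤ n) (hD : IsDyadicGrid D) (hR : R ∈ D) (hQ : Q ∈ D)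
    (h : R ⊂ Q) : ∃ P ∈ D, R ⊂ P ∧ P ⊆ Q ∧ volume P = 2 ^ n * volume R := by
  obtain ⟨j, hj⟩ := hD.side R hR
  obtain ⟨k, hk⟩ := hD.side Q hQ
  have hjk := hD.lt_of_ssubset hn hR hQ hj hk h
  obtain ⟨x, hx⟩ := hD.nonempty hR
  obtain ⟨P, hP, hPj, hxP⟩ := hD.exists_mem (j + 1) x
  refine ⟨P, hP, ⟨hD.subset_of_le hn hR hP hj hPj (by omega) hx hxP, fun hPR => ?_⟩,
    hD.subset_of_le hn hP hQ hPj hk (by omega) hxP (h.1 hx), ?_⟩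
  · have := hPj.le_of_subset hn hj hPR
    omega
  · rw [hj.volume_eq (by positivity), hPj.volume_eq (by positivity), zpow_add_one₀ two_ne_zero,
      mul_pow, mul_comm, ENNReal.ofReal_mul (by positivity), ENNReal.ofReal_pow two_pos.le]
    simp

lemma IsDyadicGrid.countable (hD : IsDyadicGrid D) : D.Countable := by
  have key : ∀ k : ℤ, {Q | Q ∈ D ∧ IsCube ((2 : ℝ) ^ k) Q}.Countable := fun k => by
    refine PairwiseDisjoint.countable_of_nonempty_interior (s := id) (fun P hP Q hQ hPQ => ?_)
      fun Q hQ => ?_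
    · exact disjoint_left.2 fun x hxP hxQ => hPQ (hD.eq_of_mem hP.1 hQ.1 hP.2 hQ.2 hxP hxQ)
    · obtain ⟨c, hc, -⟩ := hQ.2.exists_ball (by positivity)
      exact ⟨c, interior_maximal hc Metric.isOpen_ball (Metric.mem_ball_self (by positivity))⟩
  refine (countable_iUnion key).mono fun Q hQ => ?_
  obtain ⟨k, hk⟩ := hD.side Q hQ
  exact mem_iUnion.2 ⟨k, hQ, hk⟩

/-- Lebesgue differentiation along a dyadic grid, in the form of a bound at a point. -/
lemma IsDyadicGrid.ae_enorm_sub_le (hn : 1 ≤ n) (hD : IsDyadicGrid D) {f : (Fin n → ℝ) → ℝ}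
    (hf : LocallyIntegrable f volume) :
    ∀ᵐ x ∂(volume : Measure (Fin n → ℝ)), ∀ (c : ℝ) (t : ℝ≥0∞), ∀ Q ∈ D, x ∈ Q →
      (∀ R ∈ D, x ∈ R → R ⊆ Q → ‖avg f R - c‖ₑ ≤ t) → ‖f x - c‖ₑ ≤ t := by
  -- The balls need not be centred at `x`, only contain it. The exceptional set is independent of
  -- `c`, `t`, `Q`, which may therefore depend on `x`.
  filter_upwards [IsUnifLocDoublingMeasure.ae_tendsto_average volume hf 1]
    with x hx c t Q hQ hxQ hR
  choose R hRD hRk hxR using fun k : ℕ => hD.exists_mem (-(k : ℤ)) x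
  choose z hz hzR using fun k : ℕ => (hRk k).exists_ae_eq_closedBall (by positivity)
  have hlim : Filter.Tendsto (fun k : ℕ => (2 : ℝ) ^ (-(k : ℤ)) / 2) Filter.atTop
      (nhdsWithin 0 (Ioi 0)) := by
    refine tendsto_nhdsWithin_iff.2 ⟨?_, .of_forall fun k => mem_Ioi.2 (by positivity)⟩
    have := (tendsto_pow_atTop_nhds_zero_of_lt_one (r := (1 / 2 : ℝ)) (by norm_num)
      (by norm_num)).div_const 2
    simpa using this
  have h := hx z _ hlim (.of_forall fun k => by rw [one_mul]; exact hz k (hxR k))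
  have h' : Filter.Tendsto (fun k => ‖avg f (R k) - c‖ₑ) Filter.atTop (nhds ‖f x - c‖ₑ) := by
    refine ((h.sub_const c).enorm).congr fun k => ?_
    rw [avg, Measure.restrict_congr_set (hzR k)]
  obtain ⟨m, hm⟩ := hD.side Q hQ
  refine le_of_tendsto h' ?_
  filter_upwards [Filter.eventually_ge_atTop (-m).toNat] with k hk
  exact hR _ (hRD k) (hxR k) (hD.subset_of_le hn (hRD k) hQ (hRk k) hm (by omega) (hxR k) hxQ)

lemma IsDyadicGrid.enorm_avg_sub_mul_le (hD : IsDyadicGrid D) (hR : R ∈ D) {f : (Fin n → ℝ) → ℝ}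
    (hf : LocallyIntegrable f volume) (c : ℝ) :
    ‖avg f R - c‖ₑ * volume R ≤ ∫⁻ x in R, ‖f x - c‖ₑ := by
  have h0 : volume.real R ≠ 0 := (ENNReal.toReal_pos (hD.volume_ne_zero hR)
    (hD.volume_ne_top hR)).ne'
  have h1 : (avg f R - c) * volume.real R = ∫ x in R, (f x - c) := by
    rw [integral_sub (hD.integrableOn hR hf)
      (integrableOn_const (hD.volume_ne_top hR)), avg, setAverage_eq, setIntegral_const]
    simp only [smul_eq_mul]
    field_simp
  have h2 : volume R = ‖volume.real R‖ₑ := by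
    rw [Real.enorm_of_nonneg measureReal_nonneg, ofReal_measureReal (hD.volume_ne_top hR)]
  calc ‖avg f R - c‖ₑ * volume R = ‖(avg f R - c) * volume.real R‖ₑ := by rw [enorm_mul, ← h2]
    _ ≤ _ := by rw [h1]; exact enorm_integral_le_lintegral_enorm _

/-- A sparse family is Carleson. -/
lemma IsSparse.isCarleson (hD : IsDyadicGrid D) {Λ : ℝ} (hΛ : 0 < Λ)
    {S : Set (Set (Fin n → ℝ))} (hS : IsSparse D (1 / Λ) S) : IsCarleson D Λ S := by
  obtain ⟨hSD, E, hE, hdisj⟩ := hS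
  refine ⟨hSD, fun Q _ => ?_⟩
  have : Countable {P : Set (Fin n → ℝ) // P ∈ S ∧ P ⊆ Q} :=
    (hD.countable.mono (s₁ := {P | P ∈ S ∧ P ⊆ Q}) fun P hP => hSD hP.1).to_subtype
  calc ∑' P : {P : Set (Fin n → ℝ) // P ∈ S ∧ P ⊆ Q}, volume P.1
      ≤ ∑' P : {P : Set (Fin n → ℝ) // P ∈ S ∧ P ⊆ Q}, ENNReal.ofReal Λ * volume (E P.1) := by
        refine ENNReal.tsum_le_tsum fun P => ?_
        calc volume P.1 = ENNReal.ofReal Λ * (ENNReal.ofReal (1 / Λ) * volume P.1) := by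
              rw [← mul_assoc, ← ENNReal.ofReal_mul hΛ.le, mul_one_div_cancel hΛ.ne',
                ENNReal.ofReal_one, one_mul]
          _ ≤ _ := by gcongr; exact (hE _ P.2.1).2.2
    _ = ENNReal.ofReal Λ * volume (⋃ P : {P : Set (Fin n → ℝ) // P ∈ S ∧ P ⊆ Q}, E P.1) := by
        rw [ENNReal.tsum_mul_left, measure_iUnion]
        · exact fun P R hPR => hdisj P.2.1 R.2.1 fun h => hPR (Subtype.ext h)
        · exact fun P => (hE _ P.2.1).1
    _ ≤ _ := by
        gcongr
        exact iUnion_subset fun P => (hE _ P.2.1).2.1.trans P.2.2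

end Grid

/-! ### Stopping cubes: sparseness and telescoping -/

section Stopping

variable {n : ℕ} {D : Set (Set (Fin n → ℝ))} {b : (Fin n → ℝ) → ℝ}
  {t : Set (Fin n → ℝ) → ℝ≥0∞} {P Q R Q₀ : Set (Fin n → ℝ)}

/-- The mean oscillation of `b` over `R` about its average on `Q` exceeds the threshold `t Q`. -/
def Exceeds (b : (Fin n → ℝ) → ℝ) (t : Set (Fin n → ℝ) → ℝ≥0∞) (Q R : Set (Fin n → ℝ)) : Prop :=
  t Q * volume R < ∫⁻ x in R, ‖b x - avg b Q‖ₑ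

/-- The maximal proper subcubes of `Q` on which the threshold is exceeded. -/
def stoppingChildren (D : Set (Set (Fin n → ℝ))) (b : (Fin n → ℝ) → ℝ)
    (t : Set (Fin n → ℝ) → ℝ≥0∞) (Q : Set (Fin n → ℝ)) : Set (Set (Fin n → ℝ)) :=
  {R | R ∈ D ∧ R ⊂ Q ∧ Exceeds b t Q R ∧ ∀ P ∈ D, R ⊂ P → P ⊆ Q → ¬ Exceeds b t Q P}

/-- The `k`-th generation of stopping cubes descending from `Q₀`. -/
def stoppingGeneration (D : Set (Set (Fin n → ℝ))) (b : (Fin n → ℝ) → ℝ)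
    (t : Set (Fin n → ℝ) → ℝ≥0∞) (Q₀ : Set (Fin n → ℝ)) : ℕ → Set (Set (Fin n → ℝ))
  | 0 => {Q₀}
  | k + 1 => ⋃ P ∈ stoppingGeneration D b t Q₀ k, stoppingChildren D b t P

/-- The family of all stopping cubes descending from `Q₀`. -/
def stoppingFamily (D : Set (Set (Fin n → ℝ))) (b : (Fin n → ℝ) → ℝ)
    (t : Set (Fin n → ℝ) → ℝ≥0∞) (Q₀ : Set (Fin n → ℝ)) : Set (Set (Fin n → ℝ)) :=
  ⋃ k, stoppingGeneration D b t Q₀ k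

lemma stoppingGeneration_subset (hQ₀ : Q₀ ∈ D) (k : ℕ) :
    stoppingGeneration D b t Q₀ k ⊆ subcubes D Q₀ := by
  induction k with
  | zero => rintro _ rfl; exact ⟨hQ₀, subset_rfl⟩
  | succ k ih =>
    intro R hR
    obtain ⟨P, hP, hRP⟩ := mem_iUnion₂.1 hR
    exact ⟨hRP.1, hRP.2.1.1.trans (ih hP).2⟩

lemma stoppingFamily_subset (hQ₀ : Q₀ ∈ D) : stoppingFamily D b t Q₀ ⊆ subcubes D Q₀ :=
  iUnion_subset fun k => stoppingGeneration_subset hQ₀ k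

lemma self_mem_stoppingFamily : Q₀ ∈ stoppingFamily D b t Q₀ := mem_iUnion.2 ⟨0, rfl⟩

lemma mem_stoppingFamily_of_mem_stoppingChildren (hP : P ∈ stoppingFamily D b t Q₀)
    (hR : R ∈ stoppingChildren D b t P) : R ∈ stoppingFamily D b t Q₀ := by
  obtain ⟨k, hk⟩ := mem_iUnion.1 hP
  exact mem_iUnion.2 ⟨k + 1, mem_iUnion₂.2 ⟨P, hk, hR⟩⟩

lemma stoppingChildren_pairwiseDisjoint (hD : IsDyadicGrid D) :
    (stoppingChildren D b t Q).PairwiseDisjoint id := by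
  refine fun P hP R hR hPR => disjoint_left.2 fun x hxP hxR => ?_
  rcases hD.subset_or_subset hP.1 hR.1 hxP hxR with h | h
  · exact hP.2.2.2 R hR.1 (h.ssubset_of_ne hPR) hR.2.1.1 hR.2.2.1
  · exact hR.2.2.2 P hP.1 (h.ssubset_of_ne hPR.symm) hP.2.1.1 hP.2.2.1

lemma stoppingGeneration_pairwiseDisjoint (hD : IsDyadicGrid D) (k : ℕ) :
    (stoppingGeneration D b t Q₀ k).PairwiseDisjoint id := by
  induction k with
  | zero => exact pairwiseDisjoint_singleton _ _
  | succ k ih =>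
    intro P hP R hR hPR
    obtain ⟨P', hP', hPP'⟩ := mem_iUnion₂.1 hP
    obtain ⟨R', hR', hRR'⟩ := mem_iUnion₂.1 hR
    by_cases h : P' = R'
    · subst h
      exact stoppingChildren_pairwiseDisjoint hD hPP' hRR' hPR
    · exact (ih hP' hR' h).mono hPP'.2.1.1 hRR'.2.1.1

lemma exists_ancestor {j k : ℕ} (hjk : j ≤ k) (hR : R ∈ stoppingGeneration D b t Q₀ k) :
    ∃ P ∈ stoppingGeneration D b t Q₀ j, R ⊆ P := by
  induction k, hjk using Nat.le_induction generalizing R with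
  | base => exact ⟨R, hR, subset_rfl⟩
  | succ k _ ih =>
    obtain ⟨Q, hQ, hRQ⟩ := mem_iUnion₂.1 hR
    obtain ⟨P, hP, hQP⟩ := ih hQ
    exact ⟨P, hP, hRQ.2.1.1.trans hQP⟩

/-- The part of `Q` not covered by its stopping children. -/
def stoppingRemainder (D : Set (Set (Fin n → ℝ))) (b : (Fin n → ℝ) → ℝ)
    (t : Set (Fin n → ℝ) → ℝ≥0∞) (Q : Set (Fin n → ℝ)) : Set (Fin n → ℝ) :=
  Q \ ⋃ R ∈ stoppingChildren D b t Q, R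

/-- `R` lies in a child of some `P'` of generation `j`. If `P' = P`, that child was removed from the
remainder of `P`; otherwise `P` and `P'` are disjoint. -/
lemma disjoint_stoppingRemainder_of_lt (hD : IsDyadicGrid D) {j k : ℕ} (hjk : j < k)
    (hP : P ∈ stoppingGeneration D b t Q₀ j) (hR : R ∈ stoppingGeneration D b t Q₀ k) :
    Disjoint (stoppingRemainder D b t P) (stoppingRemainder D b t R) := by
  obtain ⟨R', hR', hRR'⟩ := exists_ancestor (Nat.succ_le_of_lt hjk) hR
  obtain ⟨P', hP', hRP'⟩ := mem_iUnion₂.1 hR'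
  by_cases h : P = P'
  · subst h
    exact disjoint_left.2 fun x hxP hxR => hxP.2 (mem_iUnion₂.2 ⟨R', hRP', hRR' hxR.1⟩)
  · exact (stoppingGeneration_pairwiseDisjoint hD j hP hP' h).mono sdiff_subset
      (sdiff_subset.trans (hRR'.trans hRP'.2.1.1))

lemma stoppingFamily_pairwiseDisjoint (hD : IsDyadicGrid D) :
    (stoppingFamily D b t Q₀).PairwiseDisjoint (stoppingRemainder D b t) := by
  intro P hP R hR hPR
  obtain ⟨j, hj⟩ := mem_iUnion.1 hP
  obtain ⟨k, hk⟩ := mem_iUnion.1 hR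
  rcases lt_trichotomy j k with h | rfl | h
  · exact disjoint_stoppingRemainder_of_lt hD h hj hk
  · exact (stoppingGeneration_pairwiseDisjoint hD j hj hk hPR).mono sdiff_subset sdiff_subset
  · exact (disjoint_stoppingRemainder_of_lt hD h hk hj).symm

lemma stoppingChildren_countable (hD : IsDyadicGrid D) : (stoppingChildren D b t Q).Countable :=
  hD.countable.mono fun _ hR => hR.1

lemma measurableSet_biUnion_stoppingChildren (hD : IsDyadicGrid D) :
    MeasurableSet (⋃ R ∈ stoppingChildren D b t Q, R) :=
  .biUnion (stoppingChildren_countable hD) fun _ hR => hD.measurableSet hR.1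

/-- Chebyshev's inequality, summed over the disjoint children. -/
lemma mul_volume_biUnion_stoppingChildren_le (hD : IsDyadicGrid D) (ht : t Q ≠ ⊤) {A : ℝ≥0∞}
    (hA : A ≠ 0) (h : A * ∫⁻ x in Q, ‖b x - avg b Q‖ₑ ≤ t Q * volume Q) :
    A * volume (⋃ R ∈ stoppingChildren D b t Q, R) ≤ volume Q := by
  have hsub : (⋃ R ∈ stoppingChildren D b t Q, R) ⊆ Q := iUnion₂_subset fun R hR => hR.2.1.1
  -- A zero threshold cannot be cancelled, but then the oscillation vanishes and there are no
  -- children.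
  rcases eq_or_ne (t Q) 0 with h0 | h0
  · have hint : ∫⁻ x in Q, ‖b x - avg b Q‖ₑ = 0 := by
      rw [h0, zero_mul, nonpos_iff_eq_zero, mul_eq_zero] at h
      exact h.resolve_left hA
    have : stoppingChildren D b t Q = ∅ := eq_empty_of_forall_notMem fun R hR =>
      (hR.2.2.1.trans_le (lintegral_mono_set hR.2.1.1)).not_ge (by rw [hint]; exact zero_le)
    simp [this]
  · rw [← ENNReal.mul_le_mul_iff_right h0 ht]
    calc t Q * (A * volume (⋃ R ∈ stoppingChildren D b t Q, R))
        = A * ∑' R : stoppingChildren D b t Q, t Q * volume R.1 := by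
          rw [measure_biUnion (f := fun R => R) (stoppingChildren_countable hD)
            (stoppingChildren_pairwiseDisjoint hD) fun R hR => hD.measurableSet hR.1,
            ENNReal.tsum_mul_left, mul_left_comm]
      _ ≤ A * ∑' R : stoppingChildren D b t Q, ∫⁻ x in R.1, ‖b x - avg b Q‖ₑ := by
          gcongr with R
          exact R.2.2.2.1.le
      _ = A * ∫⁻ x in ⋃ R ∈ stoppingChildren D b t Q, R, ‖b x - avg b Q‖ₑ := by
          congr 1
          exact (lintegral_biUnion (stoppingChildren_countable hD)
            (fun R hR => hD.measurableSet hR.1) (stoppingChildren_pairwiseDisjoint hD) _).symm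
      _ ≤ A * ∫⁻ x in Q, ‖b x - avg b Q‖ₑ := by gcongr
      _ ≤ _ := h

lemma isSparse_stoppingFamily (hD : IsDyadicGrid D) (hQ₀ : Q₀ ∈ D) {Λ : ℝ} (hΛ : 1 < Λ)
    (ht : ∀ Q ∈ D, t Q ≠ ⊤) (h : ∀ Q ∈ D, ENNReal.ofReal (Λ / (Λ - 1)) *
      ∫⁻ x in Q, ‖b x - avg b Q‖ₑ ≤ t Q * volume Q) :
    IsSparse D (1 / Λ) (stoppingFamily D b t Q₀) := by
  have hSD := (stoppingFamily_subset (b := b) (t := t) hQ₀).trans fun _ hQ => hQ.1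
  refine ⟨hSD, stoppingRemainder D b t, fun Q hQ => ⟨?_, sdiff_subset, ?_⟩,
    stoppingFamily_pairwiseDisjoint hD⟩
  · exact (hD.measurableSet (hSD hQ)).diff (measurableSet_biUnion_stoppingChildren hD)
  · have hΛ1 : 0 < Λ - 1 := sub_pos.2 hΛ
    have hΛ0 : 0 < Λ := one_pos.trans hΛ
    have hU := mul_volume_biUnion_stoppingChildren_le hD (ht Q (hSD hQ))
      (ENNReal.ofReal_pos.2 (by positivity)).ne' (h Q (hSD hQ))
    set U := ⋃ R ∈ stoppingChildren D b t Q, R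
    have hUQ : U ⊆ Q := iUnion₂_subset fun R hR => hR.2.1.1
    have hQtop := hD.volume_ne_top (hSD hQ)
    have hUtop : volume U ≠ ⊤ := measure_ne_top_of_subset hUQ hQtop
    rw [stoppingRemainder, measure_sdiff hUQ
      (measurableSet_biUnion_stoppingChildren hD).nullMeasurableSet hUtop]
    refine ENNReal.le_sub_of_add_le_right hUtop ?_
    rw [← ENNReal.ofReal_toReal hQtop, ← ENNReal.ofReal_toReal hUtop] at hU ⊢
    rw [← ENNReal.ofReal_mul (by positivity), ENNReal.ofReal_le_ofReal_iff (by positivity)] at hU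
    rw [← ENNReal.ofReal_mul (by positivity), ← ENNReal.ofReal_add (by positivity) (by positivity)]
    refine ENNReal.ofReal_le_ofReal ?_
    -- Now `hU` reads `Λ |U| ≤ (Λ - 1) |Q|`, up to the order of factors.
    rw [div_mul_eq_mul_div, div_le_iff₀ hΛ1] at hU
    have : 1 / Λ * (volume Q).toReal + (volume U).toReal
        = ((volume Q).toReal + Λ * (volume U).toReal) / Λ := by field_simp
    rw [this, div_le_iff₀ hΛ0]
    linarith

lemma exists_mem_stoppingChildren (hn : 1 ≤ n) (hD : IsDyadicGrid D) (hQ : Q ∈ D) (hR : R ∈ D)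
    (hRQ : R ⊆ Q) (hQQ : ¬ Exceeds b t Q Q) (h : Exceeds b t Q R) :
    ∃ P ∈ stoppingChildren D b t Q, R ⊆ P := by
  obtain ⟨P, ⟨⟨hP, hPQ⟩, hRP, hexc⟩, hmax⟩ := hD.exists_maximal hn hQ
    (T := {P | P ∈ subcubes D Q ∧ R ⊆ P ∧ Exceeds b t Q P}) (fun P hP => hP.1)
    ⟨R, ⟨hR, hRQ⟩, subset_rfl, h⟩
  refine ⟨P, ⟨hP, hPQ.ssubset_of_ne ?_, hexc, fun P' hP' hPP' hP'Q h' =>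
    hmax P' ⟨⟨hP', hP'Q⟩, hRP.trans hPP'.1, h'⟩ hPP'⟩, hRP⟩
  rintro rfl
  exact hQQ hexc

/-- By maximality the parent of `R` obeys the threshold; enlarging `R` to its parent costs the
factor `2 ^ n`. -/
lemma enorm_avg_sub_avg_le (hn : 1 ≤ n) (hD : IsDyadicGrid D) (hb : LocallyIntegrable b volume)
    (hQ : Q ∈ D) (hR : R ∈ stoppingChildren D b t Q) : ‖avg b R - avg b Q‖ₑ ≤ 2 ^ n * t Q := by
  obtain ⟨P, hP, hRP, hPQ, hvol⟩ := hD.exists_parent hn hR.1 hQ hR.2.1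
  have hnot := not_lt.1 (hR.2.2.2 P hP hRP hPQ)
  rw [← ENNReal.mul_le_mul_iff_left (hD.volume_ne_zero hR.1) (hD.volume_ne_top hR.1)]
  calc ‖avg b R - avg b Q‖ₑ * volume R ≤ ∫⁻ x in R, ‖b x - avg b Q‖ₑ :=
        hD.enorm_avg_sub_mul_le hR.1 hb _
    _ ≤ ∫⁻ x in P, ‖b x - avg b Q‖ₑ := lintegral_mono_set hRP.1
    _ ≤ t Q * volume P := hnot
    _ = 2 ^ n * t Q * volume R := by rw [hvol]; ring

/-- Telescoping through the generations. Strictness of `P ⊂ R` keeps the cubes distinct, so no term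
is counted twice. -/
lemma exists_finset_enorm_avg_sub_avg_le (hn : 1 ≤ n) (hD : IsDyadicGrid D)
    (hb : LocallyIntegrable b volume) (hQ₀ : Q₀ ∈ D) (hP : P ∈ stoppingFamily D b t Q₀) :
    ∃ F : Finset (Set (Fin n → ℝ)), (∀ R ∈ F, R ∈ stoppingFamily D b t Q₀ ∧ P ⊂ R) ∧
      ‖avg b P - avg b Q₀‖ₑ ≤ ∑ R ∈ F, 2 ^ n * t R := by
  classical
  obtain ⟨k, hk⟩ := mem_iUnion.1 hP
  clear hP
  induction k generalizing P with
  | zero =>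
    obtain rfl : P = Q₀ := hk
    exact ⟨∅, by simp⟩
  | succ k ih =>
    obtain ⟨Q, hQ, hPQ⟩ := mem_iUnion₂.1 hk
    obtain ⟨F, hF, hle⟩ := ih hQ
    refine ⟨insert Q F, fun R hR => ?_, ?_⟩
    · rcases Finset.mem_insert.1 hR with rfl | hR
      · exact ⟨mem_iUnion.2 ⟨k, hQ⟩, hPQ.2.1⟩
      · exact ⟨(hF R hR).1, hPQ.2.1.trans (hF R hR).2⟩
    · rw [Finset.sum_insert fun h => (hF Q h).2.ne rfl, ← sub_add_sub_cancel _ (avg b Q)]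
      exact (enorm_add_le _ _).trans (add_le_add (enorm_avg_sub_avg_le hn hD hb
        (stoppingGeneration_subset hQ₀ k hQ).1 hPQ) hle)

lemma ae_enorm_sub_avg_le (hn : 1 ≤ n) (hD : IsDyadicGrid D) (hb : LocallyIntegrable b volume)
    (hQ₀ : Q₀ ∈ D) (hexc : ∀ Q ∈ D, ¬ Exceeds b t Q Q) {Λ : ℝ}
    (hS : IsCarleson D Λ (stoppingFamily D b t Q₀)) :
    ∀ᵐ x ∂(volume : Measure (Fin n → ℝ)), x ∈ Q₀ → ‖b x - avg b Q₀‖ₑ ≤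
      2 ^ n * ∑' Q : stoppingFamily D b t Q₀, Q.1.indicator (fun _ => t Q) x := by
  classical
  have hSsub := stoppingFamily_subset (D := D) (b := b) (t := t) hQ₀
  have : Countable (stoppingFamily D b t Q₀) := (hD.countable.mono hS.1).to_subtype
  have hsum : ∑' Q : stoppingFamily D b t Q₀, volume Q.1 ≠ ⊤ := by
    refine ne_top_of_le_ne_top
      (ENNReal.mul_ne_top ENNReal.ofReal_ne_top (hD.volume_ne_top hQ₀)) (le_trans ?_ (hS.2 Q₀ hQ₀))
    exact ENNReal.tsum_comp_le_tsum_of_injective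
      (f := fun Q : stoppingFamily D b t Q₀ =>
        (⟨Q.1, Q.2, (hSsub Q.2).2⟩ : {P // P ∈ stoppingFamily D b t Q₀ ∧ P ⊆ Q₀}))
      (fun P Q h => Subtype.ext (Subtype.mk.inj h)) (fun P => volume P.1)
  -- Borel–Cantelli: almost every point lies in finitely many stopping cubes.
  filter_upwards [hD.ae_enorm_sub_le hn hb, ae_finite_setOfPred_mem hsum] with x hx hfin hxQ₀
  have hfin' : {Q | Q ∈ stoppingFamily D b t Q₀ ∧ x ∈ Q}.Finite :=
    (hfin.image Subtype.val).subset fun Q hQ => ⟨⟨Q, hQ.1⟩, hQ.2, rfl⟩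
  obtain ⟨P, ⟨hPS, hxP⟩, hPmin⟩ := hfin'.exists_minimal ⟨Q₀, self_mem_stoppingFamily, hxQ₀⟩
  have hPD := (hSsub hPS).1
  have h1 : ‖b x - avg b P‖ₑ ≤ t P := by
    refine hx _ _ P hPD hxP fun R hR hxR hRP => ?_
    -- Otherwise a child of `P` would contain `x`, against the minimality of `P`.
    have hnot : ¬ Exceeds b t P R := fun hPR => by
      obtain ⟨R', hR', hRR'⟩ := exists_mem_stoppingChildren hn hD hPD hR hRP (hexc P hPD) hPR
      exact hR'.2.1.2 (hPmin ⟨mem_stoppingFamily_of_mem_stoppingChildren hPS hR', hRR' hxR⟩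
        hR'.2.1.1)
    rw [← ENNReal.mul_le_mul_iff_left (hD.volume_ne_zero hR) (hD.volume_ne_top hR)]
    exact (hD.enorm_avg_sub_mul_le hR hb _).trans (not_lt.1 hnot)
  obtain ⟨F, hF, h2⟩ := exists_finset_enorm_avg_sub_avg_le hn hD hb hQ₀ hPS
  have hPF : P ∉ F := fun h => (hF P h).2.ne rfl
  have hmem : ∀ R ∈ insert P F, R ∈ stoppingFamily D b t Q₀ ∧ x ∈ R := by
    intro R hR
    rcases Finset.mem_insert.1 hR with rfl | hR
    · exact ⟨hPS, hxP⟩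
    · exact ⟨(hF R hR).1, (hF R hR).2.1 hxP⟩
  calc ‖b x - avg b Q₀‖ₑ ≤ ‖b x - avg b P‖ₑ + ‖avg b P - avg b Q₀‖ₑ := by
        rw [← sub_add_sub_cancel _ (avg b P)]
        exact enorm_add_le _ _
    _ ≤ 2 ^ n * t P + ∑ R ∈ F, 2 ^ n * t R := by
        gcongr
        exact h1.trans (le_mul_of_one_le_left' (one_le_pow₀ one_le_two))
    _ = 2 ^ n * ∑ R ∈ insert P F, t R := by
        rw [Finset.sum_insert hPF, mul_add, Finset.mul_sum]
    _ = 2 ^ n * ∑ R ∈ (insert P F).subtype (· ∈ stoppingFamily D b t Q₀),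
          R.1.indicator (fun _ => t R) x := by
        congr 1
        rw [← Finset.sum_subtype_of_mem _ fun R hR => (hmem R hR).1]
        refine Finset.sum_congr rfl fun R hR => ?_
        rw [indicator_of_mem (hmem R.1 (Finset.mem_subtype.1 hR)).2]
    _ ≤ _ := by
        gcongr
        exact ENNReal.sum_le_tsum _

end Stopping

/-! ### The weight and the BMO inequality -/

section Weight

variable {n : ℕ} {D : Set (Set (Fin n → ℝ))} {w b : (Fin n → ℝ) → ℝ} {Q : Set (Fin n → ℝ)}

lemma IsWeight.weightMass_eq (hw : IsWeight w) (hD : IsDyadicGrid D) (hQ : Q ∈ D) :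
    weightMass w Q = ENNReal.ofReal (avg w Q) * volume Q := by
  have hnn : 0 ≤ᵐ[volume.restrict Q] w :=
    ae_restrict_of_ae (hw.ae_pos.mono fun x hx => hx.le)
  have h0 : volume.real Q ≠ 0 := (ENNReal.toReal_pos (hD.volume_ne_zero hQ)
    (hD.volume_ne_top hQ)).ne'
  rw [weightMass, ← ofReal_integral_eq_lintegral_ofReal (hD.integrableOn hQ hw.locallyIntegrable)
    hnn, ← ofReal_measureReal (hD.volume_ne_top hQ), ← ENNReal.ofReal_mul' measureReal_nonneg,
    avg, setAverage_eq, smul_eq_mul]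
  congr 1
  field_simp

/-- Justifies clearing the denominator in `bmoNorm`. -/
lemma IsWeight.weightMass_ne_zero (hw : IsWeight w) (hD : IsDyadicGrid D) (hQ : Q ∈ D) :
    weightMass w Q ≠ 0 := by
  intro h
  rw [weightMass, lintegral_eq_zero_iff'
    (hw.locallyIntegrable.aestronglyMeasurable.aemeasurable.ennreal_ofReal.restrict)] at h
  have : ∀ᵐ x ∂volume.restrict Q, False := by
    filter_upwards [h, ae_restrict_of_ae hw.ae_pos] with x hx hpos
    exact hpos.not_ge (ENNReal.ofReal_eq_zero.1 hx)
  rw [Filter.eventually_false_iff_eq_bot, ae_eq_bot, Measure.restrict_eq_zero] at this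
  exact hD.volume_ne_zero hQ this

/-- The defining inequality of the weighted dyadic BMO norm. -/
lemma IsWeight.lintegral_enorm_sub_avg_le (hw : IsWeight w) (hD : IsDyadicGrid D) (hQ : Q ∈ D) :
    ∫⁻ x in Q, ‖b x - avg b Q‖ₑ ≤ bmoNorm D w b * (ENNReal.ofReal (avg w Q) * volume Q) := by
  have htop : weightMass w Q ≠ ⊤ := by
    rw [hw.weightMass_eq hD hQ]
    exact ENNReal.mul_ne_top ENNReal.ofReal_ne_top (hD.volume_ne_top hQ)
  rw [← hw.weightMass_eq hD hQ,
    ← ENNReal.div_le_iff (hw.weightMass_ne_zero hD hQ) htop]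
  exact le_iSup₂ (f := fun Q (_ : Q ∈ D) =>
    (∫⁻ x in Q, ‖b x - avg b Q‖ₑ ∂volume) / weightMass w Q) Q hQ

end Weight

end SparseBMO

theorem mainTheorem10 (n : ℕ) (hn : 1 ≤ n) :
    ∃ C : ℝ, 0 < C ∧
      ∀ (D : Set (Set (Fin n → ℝ))), SparseBMO.IsDyadicGrid D →
      ∀ (Λ : ℝ), 1 < Λ →
      ∀ (w : (Fin n → ℝ) → ℝ), SparseBMO.IsWeight w →
      ∀ (b : (Fin n → ℝ) → ℝ), SparseBMO.MemBMO D w b →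
      ∀ Q₀ ∈ D,
        ∃ S : Set (Set (Fin n → ℝ)),
          S ⊆ SparseBMO.subcubes D Q₀ ∧
          SparseBMO.IsCarleson D Λ S ∧
          SparseBMO.IsSparse D (1 / Λ) S ∧
          ¬ SparseBMO.HasInfinitelyIncreasingChain S ∧
          ∀ᵐ x ∂(volume : Measure (Fin n → ℝ)),
            ‖Q₀.indicator (fun y => b y - SparseBMO.avg b Q₀) x‖ₑ ≤
              ENNReal.ofReal (C * (Λ / (Λ - 1)) ^ 2) * SparseBMO.bmoNorm D w b *
                SparseBMO.sparseFun w S x := by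
  refine ⟨2 ^ n, by positivity, fun D hD Λ hΛ w hw b hb Q₀ hQ₀ => ?_⟩
  have hΛ1 : 0 < Λ - 1 := sub_pos.2 hΛ
  have hA : 1 ≤ Λ / (Λ - 1) := (one_le_div hΛ1).2 (by linarith)
  set A : ℝ := Λ / (Λ - 1) with hAdef
  let t : Set (Fin n → ℝ) → ℝ≥0∞ := fun Q =>
    ENNReal.ofReal A * SparseBMO.bmoNorm D w b * ENNReal.ofReal (SparseBMO.avg w Q)
  have ht : ∀ Q ∈ D, t Q ≠ ⊤ := fun Q _ => ENNReal.mul_ne_top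
    (ENNReal.mul_ne_top ENNReal.ofReal_ne_top hb.norm_lt_top.ne) ENNReal.ofReal_ne_top
  have hosc : ∀ Q ∈ D, ENNReal.ofReal A * ∫⁻ x in Q, ‖b x - SparseBMO.avg b Q‖ₑ ≤
      t Q * volume Q := fun Q hQ =>
    calc _ ≤ ENNReal.ofReal A * (SparseBMO.bmoNorm D w b *
          (ENNReal.ofReal (SparseBMO.avg w Q) * volume Q)) := by
          gcongr; exact hw.lintegral_enorm_sub_avg_le hD hQ
      _ = _ := by simp only [t]; ring
  have hexc : ∀ Q ∈ D, ¬ SparseBMO.Exceeds b t Q Q := fun Q hQ => not_lt.2 <|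
    (le_mul_of_one_le_left' (ENNReal.one_le_ofReal.2 hA)).trans (hosc Q hQ)
  have hsub := SparseBMO.stoppingFamily_subset (D := D) (b := b) (t := t) hQ₀
  have hsparse := SparseBMO.isSparse_stoppingFamily hD hQ₀ hΛ ht hosc
  have hcarl := hsparse.isCarleson hD (one_pos.trans hΛ)
  refine ⟨_, hsub, hcarl, hsparse, hD.not_hasInfinitelyIncreasingChain hn hQ₀ hsub, ?_⟩
  filter_upwards [SparseBMO.ae_enorm_sub_avg_le hn hD hb.locallyIntegrable hQ₀ hexc hcarl]
    with x hx
  by_cases hxQ : x ∈ Q₀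
  · rw [indicator_of_mem hxQ]
    refine (hx hxQ).trans ?_
    -- The argument yields the first power of `A`; the square follows from `1 ≤ A`.
    have hconst : 2 ^ n * ENNReal.ofReal A ≤ ENNReal.ofReal (2 ^ n * A ^ 2) := by
      rw [ENNReal.ofReal_mul (by positivity), ENNReal.ofReal_pow two_pos.le, ENNReal.ofReal_ofNat]
      gcongr
      exact le_self_pow₀ hA two_ne_zero
    calc 2 ^ n * ∑' Q : SparseBMO.stoppingFamily D b t Q₀, Q.1.indicator (fun _ => t Q) x
        = 2 ^ n * (ENNReal.ofReal A * SparseBMO.bmoNorm D w b *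
          SparseBMO.sparseFun w (SparseBMO.stoppingFamily D b t Q₀) x) := by
          congr 1
          rw [SparseBMO.sparseFun, ← ENNReal.tsum_mul_left]
          refine tsum_congr fun Q => ?_
          by_cases h : x ∈ Q.1 <;> simp [h, t]
      _ = 2 ^ n * ENNReal.ofReal A * SparseBMO.bmoNorm D w b *
          SparseBMO.sparseFun w (SparseBMO.stoppingFamily D b t Q₀) x := by ring
      _ ≤ _ := by gcongr
  · simp [hxQ]
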